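/- \textbf{Setting.} Let $k\ge 1$, let $\Delta(k)\subset\mathbb{R}^k$ be the probability simplex, and let $e_1,\dots,e_k$ be the standard unit vectors of $\mathbb{R}^k$. The infinite-horizon calibration game with $k$ outcomes is played in rounds $t=1,2,\dots$. Given the history $(f_1,x_1),\dots,(f_{t-1},x_{t-1})$ of earlier moves, the player chooses a probability distribution $q_t$ on $\Delta(k)$, the adversary chooses $x_t\in\{e_1,\dots,e_k\}$, possibly at random and possibly depending on the history and on $q_1,\dots,q_t$, and $f_t$ is drawn from $q_t$, independently of $x_t$ given the history. Both sides then observe $(f_t,x_t)$. A player strategy is a sequence of measurable maps (Markov kernels) that send each history to $q_t$; it does not know any horizon. A (randomized, adaptive) adversary is likewise a sequence of Markov kernels. The regret after $T\ge 1$ rounds is $$\mathrm{Reg}_T=\sup_{\lambda>0}\ \sup_{p\in\Delta(k)}\ \Big\|\frac1T\sum_{t=1}^T \mathbf 1\{\|f_t-p\|_1\le\lambda\}\,(f_t-x_t)\Big\|_1 .$$ \textbf{Theorem.} There is an absolute constant $c>0$ such that for every $k\ge 1$ there is a player strategy for the infinite-horizon calibration game with $k$ outcomes for which, against any adversary, almost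 surely $$\limsup_{T\to\infty}\ \frac{\sqrt T}{\sqrt{3k\log(2T)+\frac{ck^4}{2}\log T}}\cdot \mathrm{Reg}_T\ \le\ 60 .$$ In particular, against any adversary $\mathrm{Reg}_T\to 0$ almost surely, that is, the strategy is Hannan consistent. -/

import Mathlib

open MeasureTheory ProbabilityTheory Filter Topology

noncomputable section

namespace Calibration

/-- The `ℓ₁` norm on `ℝ^k`. -/
def l1Norm {k : ℕ} (v : Fin k → ℝ) : ℝ := ∑ i, |v i|

/-- The player's set of moves: the probability simplex `Δ(k)`. -/
abbrev Forecast (k : ℕ) : Type := stdSimplex ℝ (Fin k)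

/-- The adversary's set of moves: the vertices of `Δ(k)`, named by their index. -/
abbrev Outcome (k : ℕ) : Type := Fin k

/-- The standard unit vector of `ℝ^k` that belongs to an outcome. -/
def unitVector {k : ℕ} (x : Outcome k) : Fin k → ℝ := Pi.single x 1

/-- The two moves `(f, x)` of one round. -/
abbrev Round (k : ℕ) : Type := Forecast k × Outcome k

/-- The moves of the first `t` rounds, seen by both sides before the next round. -/
abbrev History (k t : ℕ) : Type := Fin t → Round k

/-- The transformed payoff `1{‖f - p‖₁ ≤ r} • (f - x)`. -/
def payoff {k : ℕ} (r : ℝ) (p : Forecast k) (m : Round k) : Fin k → ℝ :=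
  open Classical in
  if l1Norm (m.1.1 - p.1) ≤ r then m.1.1 - unitVector m.2 else 0

/-- The regret after `T` rounds: the supremum over all radii `r > 0` and all centres `p ∈ Δ(k)` of
`‖(1/T) ∑_{t ≤ T} 1{‖f_t - p‖₁ ≤ r} • (f_t - x_t)‖₁`. Round `t` of the game is `ω (t - 1)`. -/
def regret {k : ℕ} (T : ℕ) (ω : ℕ → Round k) : ℝ :=
  ⨆ s : Set.Ioi (0 : ℝ) × Forecast k,
    l1Norm ((T : ℝ)⁻¹ • ∑ t ∈ Finset.range T, payoff s.1.1 s.2 (ω t))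

/-- A player strategy for the infinite game: after each history of `t` rounds, a mixed move
(a probability distribution on `Δ(k)`). -/
structure PlayerStrategy (k : ℕ) where
  move : (t : ℕ) → Kernel (History k t) (Forecast k)
  isMarkov : ∀ t, IsMarkovKernel (move t)

/-- A randomized adaptive adversary: after each history of `t` rounds, a distribution on outcomes.
An adversary is chosen after the player's strategy, which is a function of the history; so it
also has access to the player's mixed moves, including the one of the current round. -/
structure AdversaryStrategy (k : ℕ) where
  move : (t : ℕ) → Kernel (History k t) (Outcome k)
  isMarkov : ∀ t, IsMarkovKernel (move t)

/-- The law of the next round given the past: the player and the adversary draw their moves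
independently of each other, given the history. -/
def roundKernel {k : ℕ} (π : PlayerStrategy k) (a : AdversaryStrategy k) (t : ℕ) :
    Kernel (History k t) (Round k) :=
  π.move t ×ₖ a.move t

instance roundKernel_isMarkov {k : ℕ} (π : PlayerStrategy k) (a : AdversaryStrategy k) (t : ℕ) :
    IsMarkovKernel (roundKernel π a t) := by
  have := π.isMarkov t
  have := a.isMarkov t
  unfold roundKernel
  infer_instance

/-- Rounds `0, …, n` of a play, as a history of `n + 1` rounds. -/
def toHistory {k : ℕ} (n : ℕ) (h : (i : Finset.Iic n) → Round k) : History k (n + 1) :=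
  fun i => h ⟨i.1, Finset.mem_Iic.2 (Nat.lt_succ_iff.1 i.2)⟩

theorem measurable_toHistory {k : ℕ} (n : ℕ) : Measurable (toHistory (k := k) n) :=
  measurable_pi_lambda _ fun _ => measurable_pi_apply _

/-- The law of the infinite play, by the Ionescu-Tulcea theorem. -/
def playLaw {k : ℕ} (π : PlayerStrategy k) (a : AdversaryStrategy k) : Measure (ℕ → Round k) :=
  Kernel.trajMeasure (X := fun _ => Round k)
    (roundKernel π a 0 (fun i : Fin 0 => i.elim0))
    (fun n => (roundKernel π a (n + 1)).comap (toHistory n) (measurable_toHistory n))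

/-- The supremum in the regret is that of a bounded family. -/
theorem bddAbove_regret {k : ℕ} (T : ℕ) (ω : ℕ → Round k) :
    BddAbove (Set.range fun s : Set.Ioi (0 : ℝ) × Forecast k =>
      l1Norm ((T : ℝ)⁻¹ • ∑ t ∈ Finset.range T, payoff s.1.1 s.2 (ω t))) := by
  refine ⟨∑ i, |(T : ℝ)⁻¹| * ∑ t ∈ Finset.range T, |((ω t).1.1 - unitVector (ω t).2) i|, ?_⟩
  rintro _ ⟨s, rfl⟩
  simp only [l1Norm, Pi.smul_apply, smul_eq_mul, abs_mul, Finset.sum_apply]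
  refine Finset.sum_le_sum fun i _ => mul_le_mul_of_nonneg_left ?_ (abs_nonneg _)
  refine (Finset.abs_sum_le_sum_abs _ _).trans (Finset.sum_le_sum fun t _ => ?_)
  unfold payoff
  split_ifs
  · exact le_rfl
  · simp

end Calibration

end

/-!
The strategy runs exponential weights against a finite family of tests and is restarted in epochs
of doubling length, so it needs no horizon. In epoch `j`, which has `2 ^ j` rounds, all forecasts
lie on the grid of points `n / m` of the simplex with `m = 2 ^ j`. A test is a sign vector (a
direction for the `ℓ₁` norm) together with a coded subset of the grid.

The traces of all `ℓ₁` balls on the grid are among the coded subsets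
(`exists_pattern_selects_iff`): in each orthant around the integer part of the scaled centre the
`ℓ₁` distance is an integer plus an offset that depends on the orthant only. So a ball is described
by an integer base point, an integer level and one bounded correction per orthant, which gives
`O(m ^ (k + 1))` codes; the `2 ^ k` corrections only enter the constant. Hence the logarithm of the
number of tests is at most `(k + 1) * j` plus a constant that depends on `k`, and bounds on the
scores of the tests bound the regret without any discretization error (`l1Norm_sum_payoff_le`).

Given the weights of the tests, the player solves a one-round zero-sum game. If the law of the
outcome were known, a grid point next to it would make every test gain at most `2 * k / m`; by the
minimax theorem some mixed forecast does so, on weighted average, against every outcome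
(`exists_mixed_forecast`). As the gains are bounded by `2`, the exponential potential grows in
expectation by a factor at most `1 + 2 * k * η / m + 4 * η ^ 2` per round
(`lintegral_potential_succ_le`). With `η = √(j / 2 ^ j) / 2`, Markov's inequality and the
Borel-Cantelli lemma show that almost surely, from some round on, every score is at most
`10 * k * √(j * 2 ^ j)` (`ae_eventually_score_le`). These bounds add up geometrically over the
epochs (`exists_l1Norm_sum_payoff_le`), so `√T` times the regret is at most
`60 * k * √(log T) + o(1)`; this is the claim, with room to spare for the constant `c = 8`.

Measurability of the strategy is not an issue, because it depends on the history only through the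
grid cells of the forecasts and the outcomes, which range over a countable set.
-/

noncomputable section

namespace Calibration

/-! ### The `ℓ₁` norm and forecasts -/

theorem l1Norm_nonneg {k : ℕ} (v : Fin k → ℝ) : 0 ≤ l1Norm v :=
  Finset.sum_nonneg fun _ _ => abs_nonneg _

theorem l1Norm_add_le {k : ℕ} (v w : Fin k → ℝ) : l1Norm (v + w) ≤ l1Norm v + l1Norm w := by
  unfold l1Norm
  rw [← Finset.sum_add_distrib]
  exact Finset.sum_le_sum fun i _ => abs_add_le _ _

theorem l1Norm_smul {k : ℕ} (c : ℝ) (v : Fin k → ℝ) : l1Norm (c • v) = |c| * l1Norm v := by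
  simp [l1Norm, abs_mul, Finset.mul_sum]

theorem l1Norm_sum_le {k : ℕ} {ι : Type*} (s : Finset ι) (v : ι → Fin k → ℝ) :
    l1Norm (∑ i ∈ s, v i) ≤ ∑ i ∈ s, l1Norm (v i) := by
  classical
  induction s using Finset.induction_on with
  | empty => simp [l1Norm]
  | insert a s ha ih =>
    rw [Finset.sum_insert ha, Finset.sum_insert ha]
    exact (l1Norm_add_le _ _).trans (by gcongr)

theorem l1Norm_sub_le_two {k : ℕ} {v w : Fin k → ℝ} (hv : v ∈ stdSimplex ℝ (Fin k))
    (hw : w ∈ stdSimplex ℝ (Fin k)) : l1Norm (v - w) ≤ 2 := by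
  calc l1Norm (v - w) ≤ ∑ i, (v i + w i) := Finset.sum_le_sum fun i _ => by
        rw [Pi.sub_apply, abs_le]
        constructor <;> linarith [hv.1 i, hw.1 i]
    _ = 2 := by rw [Finset.sum_add_distrib, hv.2, hw.2]; norm_num

theorem unitVector_mem {k : ℕ} (x : Outcome k) : unitVector x ∈ stdSimplex ℝ (Fin k) :=
  single_mem_stdSimplex ℝ x

theorem l1Norm_payoff_le {k : ℕ} (r : ℝ) (p : Forecast k) (m : Round k) :
    l1Norm (payoff r p m) ≤ 2 := by
  unfold payoff
  split_ifs
  · exact l1Norm_sub_le_two m.1.2 (unitVector_mem _)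
  · simp [l1Norm]

/-- The sign `±1` encoded by a Boolean. -/
def boolSign (b : Bool) : ℝ := if b then 1 else -1

theorem abs_boolSign (b : Bool) : |boolSign b| = 1 := by
  cases b <;> simp [boolSign]

theorem sum_boolSign_mul_le {k : ℕ} (s : Fin k → Bool) (v : Fin k → ℝ) :
    |∑ i, boolSign (s i) * v i| ≤ l1Norm v := by
  refine (Finset.abs_sum_le_sum_abs _ _).trans (Finset.sum_le_sum fun i _ => ?_)
  rw [abs_mul, abs_boolSign, one_mul]

theorem exists_sum_boolSign_mul_eq {k : ℕ} (v : Fin k → ℝ) :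
    ∃ s : Fin k → Bool, ∑ i, boolSign (s i) * v i = l1Norm v := by
  refine ⟨fun i => decide (0 ≤ v i), Finset.sum_congr rfl fun i _ => ?_⟩
  by_cases h : 0 ≤ v i
  · simp [boolSign, h, abs_of_nonneg h]
  · simp [boolSign, h, abs_of_neg (not_le.1 h)]

/-! ### Grids in the simplex -/

/-- The grid of mesh `1 / m` in the simplex: a point `n / m` is stored as its vector `n` of
numerators, which sum up to `m`. -/
abbrev Grid (k m : ℕ) : Type := {n : Fin k → ℕ // ∑ i, n i = m}

instance (k m : ℕ) : Fintype (Grid k m) :=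
  Fintype.subtype (Finset.piAntidiag Finset.univ m) (by simp)

/-- The forecast `n / m` named by a grid point. -/
def gridPoint {k m : ℕ} [NeZero m] (n : Grid k m) : Forecast k :=
  ⟨fun i => n.1 i / m, fun i => by positivity, by
    rw [← Finset.sum_div, ← Nat.cast_sum, n.2]
    exact div_self (NeZero.ne _)⟩

/-- The lower corner of the cell of the grid of mesh `1 / m` that holds a forecast. -/
def cell {k : ℕ} (m : ℕ) (f : Forecast k) : Fin k → ℕ := fun i => ⌊(m : ℝ) * f.1 i⌋₊

theorem cell_gridPoint {k m : ℕ} [NeZero m] (n : Grid k m) : cell m (gridPoint n) = n.1 := by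
  ext i
  have : (m : ℝ) ≠ 0 := NeZero.ne _
  simp [cell, gridPoint, mul_div_cancel₀ _ this]

theorem measurable_cell {k : ℕ} (m : ℕ) : Measurable (cell (k := k) m) :=
  measurable_pi_lambda _ fun i => Nat.measurable_floor.comp
    (((measurable_pi_apply i).comp measurable_subtype_coe).const_mul _)

theorem exists_gridPoint_near {k m : ℕ} [NeZero m] [NeZero k] {y : Fin k → ℝ}
    (hy : y ∈ stdSimplex ℝ (Fin k)) :
    ∃ n : Grid k m, l1Norm ((gridPoint n).1 - y) ≤ 2 * k / m := by
  have hm : (0 : ℝ) < m := Nat.cast_pos.2 (NeZero.pos m)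
  set a : Fin k → ℕ := fun i => ⌊(m : ℝ) * y i⌋₊ with ha
  have ha1 : ∀ i, (a i : ℝ) ≤ m * y i := fun i => Nat.floor_le (mul_nonneg hm.le (hy.1 i))
  have ha2 : ∀ i, m * y i < a i + 1 := fun i => Nat.lt_floor_add_one _
  have hsy : ∑ i, (m : ℝ) * y i = m := by rw [← Finset.mul_sum, hy.2, mul_one]
  have hle : ∑ i, a i ≤ m := by
    have : (∑ i, (a i : ℝ)) ≤ m := hsy ▸ Finset.sum_le_sum fun i _ => ha1 i
    exact_mod_cast this
  have hr : ((m - ∑ i, a i : ℕ) : ℝ) ≤ k := by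
    rw [Nat.cast_sub hle, Nat.cast_sum]
    have : ∑ i, (m : ℝ) * y i ≤ ∑ i : Fin k, ((a i : ℝ) + 1) :=
      Finset.sum_le_sum fun i _ => (ha2 i).le
    rw [hsy, Finset.sum_add_distrib] at this
    simp at this
    linarith
  -- The mass lost by rounding down is given to the outcome `0`.
  have hsum : ∑ i, (a + Pi.single 0 (m - ∑ i, a i) : Fin k → ℕ) i = m := by
    simp [Finset.sum_add_distrib, Finset.sum_pi_single', Pi.add_apply]
    omega
  refine ⟨⟨a + Pi.single 0 (m - ∑ i, a i), hsum⟩, ?_⟩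
  have key : ∀ i, |(gridPoint (m := m) ⟨a + Pi.single 0 (m - ∑ i, a i), hsum⟩).1 i - y i|
      ≤ (1 + (Pi.single (0 : Fin k) ((m - ∑ i, a i : ℕ) : ℝ) : Fin k → ℝ) i) / m := by
    intro i
    have e : ((Pi.single (0 : Fin k) (m - ∑ i, a i) : Fin k → ℕ) i : ℝ)
        = (Pi.single (0 : Fin k) ((m - ∑ i, a i : ℕ) : ℝ) : Fin k → ℝ) i := by
      by_cases h : i = 0
      · subst h; simp
      · simp [h]
    have e0 : 0 ≤ (Pi.single (0 : Fin k) ((m - ∑ i, a i : ℕ) : ℝ) : Fin k → ℝ) i := by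
      rw [← e]; positivity
    simp only [gridPoint, Pi.add_apply, Nat.cast_add, e]
    rw [div_sub' hm.ne', abs_div, abs_of_pos hm]
    refine div_le_div_of_nonneg_right ?_ hm.le
    rw [abs_le]
    constructor <;> linarith [ha1 i, ha2 i]
  calc _ ≤ ∑ i, (1 + (Pi.single (0 : Fin k) ((m - ∑ i, a i : ℕ) : ℝ) : Fin k → ℝ) i) / m :=
        Finset.sum_le_sum fun i _ => key i
    _ = (k + ((m - ∑ i, a i : ℕ) : ℝ)) / m := by
        rw [← Finset.sum_div, Finset.sum_add_distrib, Finset.sum_pi_single']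
        simp
    _ ≤ 2 * k / m := by gcongr; linarith

/-! ### Traces of balls on the grid -/

/-- Codes of subsets of the grid of mesh `1 / m`, among them the traces of all `ℓ₁` balls. A code
is a base point `a`, a level `L` and a correction of the level for each of the `2 ^ k` orthants
around `a`. There are `O(m ^ (k + 1))` of them as `m` grows. -/
abbrev Pattern (k m : ℕ) : Type :=
  (Fin k → Fin (m + 1)) × Fin (2 * m + 1) × ((Fin k → Bool) → Fin (2 * k + 1))

/-- The subset of the grid that belongs to a code: `n` is selected if its distance from the base
point is at most the level for its orthant. Corrections are stored with an offset `k`. -/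
def Pattern.Selects {k m : ℕ} (c : Pattern k m) (n : Fin k → ℕ) : Prop :=
  ∑ i, |(n i : ℤ) - ((c.1 i : ℕ) : ℤ)| ≤
    ((c.2.1 : ℕ) : ℤ) + ((c.2.2 fun i => decide (n i ≤ (c.1 i : ℕ)) : ℕ) : ℤ) - k

/-- Scale a ball of centre `p` by `m` and split the coordinates of the centre into integer parts
`a i` and fractional parts `θ i`. Then `|n i - m * p i|` is `|n i - a i| ± θ i`, with a sign that
depends on the orthant only, so in each orthant the ball is cut out by an integer threshold for
`∑ i, |n i - a i|`, and the thresholds of the orthants differ by at most `k` from a common one. -/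
theorem exists_pattern_selects_iff {k m : ℕ} [NeZero m] (p : Forecast k) {r : ℝ} (hr : 0 < r) :
    ∃ c : Pattern k m, ∀ n : Grid k m,
      c.Selects n.1 ↔ l1Norm ((gridPoint n).1 - p.1) ≤ r := by
  have hm : (0 : ℝ) < m := Nat.cast_pos.2 (NeZero.pos m)
  have hp1 : ∀ i, p.1 i ≤ 1 := fun i => by
    rw [← p.2.2]; exact Finset.single_le_sum (fun j _ => p.2.1 j) (Finset.mem_univ i)
  set a : Fin k → ℕ := fun i => ⌊(m : ℝ) * p.1 i⌋₊ with ha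
  have ha1 : ∀ i, (a i : ℝ) ≤ m * p.1 i := fun i => Nat.floor_le (mul_nonneg hm.le (p.2.1 i))
  have ha2 : ∀ i, m * p.1 i < a i + 1 := fun i => Nat.lt_floor_add_one _
  have ham : ∀ i, a i < m + 1 := fun i => by
    have : (a i : ℝ) < m + 1 := by nlinarith [ha1 i, hp1 i]
    exact_mod_cast this
  set θ : Fin k → ℝ := fun i => m * p.1 i - a i with hθ
  have hθ0 : ∀ i, 0 ≤ θ i := fun i => by simp only [hθ]; linarith [ha1 i]
  have hθ1 : ∀ i, θ i ≤ 1 := fun i => by simp only [hθ]; linarith [ha2 i]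
  -- The cap at `2 * m` costs nothing, as the simplex has diameter `2`.
  set Λ : ℝ := min (m * r) (2 * m) with hΛ
  have hΛ0 : 0 ≤ Λ := le_min (by positivity) (by positivity)
  set L : ℕ := ⌊Λ⌋₊ with hL
  have hL1 : (L : ℝ) ≤ Λ := Nat.floor_le hΛ0
  have hL2 : Λ < L + 1 := Nat.lt_floor_add_one _
  have hLm : L < 2 * m + 1 := by
    have : (L : ℝ) < 2 * m + 1 := by linarith [min_le_right ((m : ℝ) * r) (2 * m)]
    exact_mod_cast this
  have hb : ∀ s : Fin k → Bool, |∑ i, boolSign (s i) * θ i| ≤ k := fun s => by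
    refine (sum_boolSign_mul_le s θ).trans ?_
    calc l1Norm θ ≤ ∑ _i : Fin k, (1 : ℝ) := Finset.sum_le_sum fun i _ => by
          rw [abs_of_nonneg (hθ0 i)]; exact hθ1 i
      _ = k := by simp
  set F : (Fin k → Bool) → ℤ := fun s => ⌊Λ - ∑ i, boolSign (s i) * θ i⌋ with hF
  have hF1 : ∀ s, (L : ℤ) - k ≤ F s := fun s => by
    refine Int.le_floor.2 ?_
    push_cast
    linarith [(abs_le.1 (hb s)).2]
  have hF2 : ∀ s, F s < L + k + 1 := fun s => by
    refine Int.floor_lt.2 ?_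
    push_cast
    linarith [(abs_le.1 (hb s)).1]
  refine ⟨⟨fun i => ⟨a i, ham i⟩, ⟨L, hLm⟩, fun s => ⟨(F s - L + k).toNat, by
    have := hF1 s; have := hF2 s; omega⟩⟩, fun n => ?_⟩
  set s : Fin k → Bool := fun i => decide (n.1 i ≤ a i) with hs
  have hdist : ∑ i, |(n.1 i : ℝ) - m * p.1 i|
      = ((∑ i, |(n.1 i : ℤ) - (a i : ℤ)| : ℤ) : ℝ) + ∑ i, boolSign (s i) * θ i := by
    push_cast
    rw [← Finset.sum_add_distrib]
    refine Finset.sum_congr rfl fun i _ => ?_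
    by_cases h : n.1 i ≤ a i
    · have h' : (n.1 i : ℝ) ≤ a i := by exact_mod_cast h
      rw [abs_of_nonpos (by linarith [ha1 i]), abs_of_nonpos (by linarith)]
      simp only [hs, h, boolSign, hθ]
      simp
    · have h' : (a i : ℝ) + 1 ≤ n.1 i := by exact_mod_cast not_le.1 h
      rw [abs_of_nonneg (by linarith [ha2 i]), abs_of_nonneg (by linarith)]
      simp only [hs, h, boolSign, hθ]
      simp
  have hscale : ∑ i, |(n.1 i : ℝ) - m * p.1 i| = m * l1Norm ((gridPoint n).1 - p.1) := by
    unfold l1Norm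
    rw [Finset.mul_sum]
    refine Finset.sum_congr rfl fun i _ => ?_
    rw [← abs_of_pos hm, ← abs_mul, abs_of_pos hm]
    simp only [gridPoint, Pi.sub_apply]
    congr 1
    field_simp
  have h2 := l1Norm_sub_le_two (gridPoint n).2 p.2
  have hle : l1Norm ((gridPoint n).1 - p.1) ≤ r
      ↔ ∑ i, |(n.1 i : ℝ) - m * p.1 i| ≤ Λ := by
    rw [hscale, hΛ, le_min_iff, mul_le_mul_iff_right₀ hm]
    constructor
    · intro h
      exact ⟨h, by nlinarith⟩
    · exact fun h => h.1
  rw [hle, hdist, ← le_sub_iff_add_le, ← Int.le_floor]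
  unfold Pattern.Selects
  have := hF1 s
  have e : (((F s - L + k).toNat : ℕ) : ℤ) = F s - L + k := Int.toNat_of_nonneg (by omega)
  change _ ≤ (L : ℤ) + (((F s - L + k).toNat : ℕ) : ℤ) - k ↔ _ ≤ F s
  rw [e]
  constructor <;> intro h <;> linarith

/-! ### Tests and their gains -/

/-- A test: a direction, given by a vector of signs, and a subset of the grid. -/
abbrev Test (k m : ℕ) : Type := (Fin k → Bool) × Pattern k m

/-- What a test collects from one round in which the forecast is the grid point `n / m` and the
outcome is `x`: the component of `n / m - x` in its direction, if `n` is selected. -/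
def gain {k m : ℕ} (g : Test k m) (n : Fin k → ℕ) (x : Outcome k) : ℝ :=
  open Classical in
  if g.2.Selects n then ∑ i, boolSign (g.1 i) * ((n i : ℝ) / m - unitVector x i) else 0

theorem gain_grid {k m : ℕ} [NeZero m] (g : Test k m) (n : Grid k m) (x : Outcome k) :
    gain g n.1 x = open Classical in
      if g.2.Selects n.1 then ∑ i, boolSign (g.1 i) * ((gridPoint n).1 - unitVector x) i else 0 :=
  rfl

theorem abs_gain_le {k m : ℕ} [NeZero m] (g : Test k m) (n : Grid k m) (x : Outcome k) :
    |gain g n.1 x| ≤ 2 := by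
  rw [gain_grid]
  split_ifs
  · exact (sum_boolSign_mul_le _ _).trans (l1Norm_sub_le_two (gridPoint n).2 (unitVector_mem x))
  · simp

/-- Tests dominate the payoffs of all balls, as long as the forecasts are on the grid. -/
theorem l1Norm_sum_payoff_le {k m : ℕ} [NeZero m] {ι : Type*} (s : Finset ι) (ω : ι → Round k)
    (hω : ∀ t ∈ s, (ω t).1 ∈ Set.range (gridPoint (k := k) (m := m))) {u : ℝ}
    (hu : ∀ g : Test k m, ∑ t ∈ s, gain g (cell m (ω t).1) (ω t).2 ≤ u)
    {r : ℝ} (hr : 0 < r) (p : Forecast k) :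
    l1Norm (∑ t ∈ s, payoff r p (ω t)) ≤ u := by
  obtain ⟨c, hc⟩ := exists_pattern_selects_iff (m := m) p hr
  obtain ⟨σ, hσ⟩ := exists_sum_boolSign_mul_eq (∑ t ∈ s, payoff r p (ω t))
  rw [← hσ]
  refine le_of_eq_of_le ?_ (hu (σ, c))
  simp only [Finset.sum_apply, Finset.mul_sum]
  rw [Finset.sum_comm]
  refine Finset.sum_congr rfl fun t ht => ?_
  obtain ⟨n, hn⟩ := hω t ht
  rw [← hn, cell_gridPoint, gain_grid]
  have := hc n
  unfold payoff
  rw [← hn]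
  by_cases h : c.Selects n.1
  · rw [if_pos h, if_pos (this.1 h)]
  · rw [if_neg h, if_neg (fun h' => h (this.2 h'))]
    simp

/-- Finite minimax: if against each mixed move `y` of the opponent some pure move costs at most
`v`, then a single mixed move costs at most `v` against all moves of the opponent. -/
theorem exists_mixed_move_le {A X : Type*} [Fintype A] [Fintype X] [Nonempty X]
    (M : A → X → ℝ) (v : ℝ) (h : ∀ y ∈ stdSimplex ℝ X, ∃ a, ∑ x, y x * M a x ≤ v) :
    ∃ q ∈ stdSimplex ℝ A, ∀ x, ∑ a, q a * M a x ≤ v := by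
  classical
  obtain ⟨x₀⟩ := ‹Nonempty X›
  obtain ⟨a₀, -⟩ := h _ (single_mem_stdSimplex ℝ x₀)
  set f : (A → ℝ) → (X → ℝ) → ℝ := fun q y => ∑ a, q a * ∑ x, y x * M a x with hf
  have hlin1 : ∀ y, IsLinearMap ℝ fun q => f q y := fun y =>
    ⟨fun a b => by simp only [hf, Pi.add_apply, add_mul, Finset.sum_add_distrib],
     fun a b => by simp only [hf, Pi.smul_apply, smul_eq_mul, Finset.mul_sum, mul_assoc]⟩
  have hlin2 : ∀ q, IsLinearMap ℝ fun y => f q y := fun q =>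
    ⟨fun a b => by simp only [hf, Pi.add_apply, add_mul, mul_add, Finset.sum_add_distrib],
     fun a b => by
      simp only [hf, Pi.smul_apply, smul_eq_mul, Finset.mul_sum]
      refine Finset.sum_congr rfl fun i _ => Finset.sum_congr rfl fun j _ => by ring⟩
  obtain ⟨q, hq, y, hy, hs⟩ := Sion.exists_isSaddlePointOn (f := f)
    (X := stdSimplex ℝ A) (Y := stdSimplex ℝ X)
    ⟨_, single_mem_stdSimplex ℝ a₀⟩ (convex_stdSimplex ℝ _) (isCompact_stdSimplex ℝ _)
    (fun y _ => (by simp only [hf]; fun_prop :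
      Continuous fun q => f q y).lowerSemicontinuous.lowerSemicontinuousOn _)
    (fun y _ => ((hlin1 y).mk' _ |>.convexOn (convex_stdSimplex ℝ _)).quasiconvexOn)
    (convex_stdSimplex ℝ _) ⟨_, single_mem_stdSimplex ℝ x₀⟩ (isCompact_stdSimplex ℝ _)
    (fun q _ => (by simp only [hf]; fun_prop :
      Continuous fun y => f q y).upperSemicontinuous.upperSemicontinuousOn _)
    (fun q _ => ((hlin2 q).mk' _ |>.concaveOn (convex_stdSimplex ℝ _)).quasiconcaveOn)
  refine ⟨q, hq, fun x => ?_⟩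
  obtain ⟨a, ha⟩ := h y hy
  have hsx := hs _ (single_mem_stdSimplex ℝ a) _ (single_mem_stdSimplex ℝ x)
  have e1 : f q (Pi.single x 1) = ∑ a, q a * M a x := by
    simp [hf, Pi.single_apply]
  have e2 : f (Pi.single a 1) y = ∑ x, y x * M a x := by
    simp [hf, Pi.single_apply]
  rw [e1, e2] at hsx
  exact hsx.trans ha

/-- The value of the weighted one-round game is small: if the outcome has a known law, the player
forecasts a grid point next to it, and the minimax theorem exchanges the order of the moves. -/
theorem exists_mixed_forecast {k m : ℕ} [NeZero m] [NeZero k] (W : Test k m → ℝ)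
    (hW : ∀ g, 0 ≤ W g) :
    ∃ q ∈ stdSimplex ℝ (Grid k m), ∀ x : Outcome k,
      ∑ n, q n * ∑ g, W g * gain g n.1 x ≤ 2 * k / m * ∑ g, W g := by
  refine exists_mixed_move_le (fun (n : Grid k m) x => ∑ g, W g * gain g n.1 x) _ fun y hy => ?_
  obtain ⟨n, hn⟩ := exists_gridPoint_near (m := m) hy
  refine ⟨n, ?_⟩
  -- Averaging `n / m - x` over the law `y` of the outcome leaves `n / m - y`.
  have hg : ∀ g : Test k m, ∑ x, y x * gain g n.1 x ≤ 2 * k / m := by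
    intro g
    simp only [gain_grid]
    split_ifs with hsel
    · have : ∑ x, y x * ∑ i, boolSign (g.1 i) * ((gridPoint n).1 - unitVector x) i
          = ∑ i, boolSign (g.1 i) * ((gridPoint n).1 - y) i := by
        simp only [Finset.mul_sum]
        rw [Finset.sum_comm]
        refine Finset.sum_congr rfl fun i _ => ?_
        have h1 : ∑ x, y x * unitVector x i = y i := by
          rw [Finset.sum_eq_single i] <;> simp +contextual [unitVector]
        calc _ = boolSign (g.1 i) *
              ((∑ x, y x) * (gridPoint n).1 i - ∑ x, y x * unitVector x i) := by
              rw [Finset.sum_mul, ← Finset.sum_sub_distrib, Finset.mul_sum]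
              refine Finset.sum_congr rfl fun x _ => ?_
              simp only [Pi.sub_apply]
              ring
          _ = _ := by rw [h1, hy.2, one_mul]; rfl
      rw [this]
      exact (le_abs_self _).trans ((sum_boolSign_mul_le _ _).trans hn)
    · simp
      positivity
  calc ∑ x, y x * ∑ g, W g * gain g n.1 x = ∑ g, W g * ∑ x, y x * gain g n.1 x := by
        simp only [Finset.mul_sum]
        rw [Finset.sum_comm]
        refine Finset.sum_congr rfl fun g _ => Finset.sum_congr rfl fun x _ => by ring
    _ ≤ ∑ g, W g * (2 * k / m) := Finset.sum_le_sum fun g _ =>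
        mul_le_mul_of_nonneg_left (hg g) (hW g)
    _ = _ := by rw [← Finset.sum_mul, mul_comm]

theorem card_test {k m : ℕ} : Fintype.card (Test k m)
    = 2 ^ k * ((m + 1) ^ k * ((2 * m + 1) * (2 * k + 1) ^ 2 ^ k)) := by
  simp [Fintype.card_prod, Fintype.card_pi]

/-! ### The strategy -/

/-- Learning rate of epoch `j`, which has `2 ^ j` rounds. -/
def learningRate (j : ℕ) : ℝ := √((j : ℝ) / 2 ^ j) / 2

theorem learningRate_nonneg (j : ℕ) : 0 ≤ learningRate j := by
  unfold learningRate; positivity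

theorem learningRate_le (j : ℕ) : learningRate j ≤ 1 / 2 := by
  unfold learningRate
  have : (j : ℝ) / 2 ^ j ≤ 1 := by
    rw [div_le_one (by positivity)]
    exact_mod_cast (Nat.lt_two_pow_self (n := j)).le
  have := Real.sqrt_le_one.2 this
  linarith

/-- Total gain of a test in the rounds of epoch `j` before round `t`. Epoch `j` starts with round
`2 ^ j - 1` and plays on the grid of mesh `1 / 2 ^ j`. -/
def score {k : ℕ} (j t : ℕ) (g : Test k (2 ^ j)) (ω : ℕ → Round k) : ℝ :=
  ∑ s ∈ Finset.Ico (2 ^ j - 1) t, gain g (cell (2 ^ j) (ω s).1) (ω s).2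

/-- What the strategy remembers of a history of `t` rounds in epoch `j`: the cells of the forecasts
and the outcomes. It takes countably many values. -/
def digest {k t : ℕ} (j : ℕ) (h : History k t) : Fin t → (Fin k → ℕ) × Outcome k :=
  fun s => (cell (2 ^ j) (h s).1, (h s).2)

theorem measurable_digest {k t : ℕ} (j : ℕ) : Measurable (digest (k := k) (t := t) j) :=
  measurable_pi_lambda _ fun s =>
    ((measurable_cell _).comp (measurable_fst.comp (measurable_pi_apply s))).prodMk
      (measurable_snd.comp (measurable_pi_apply s))

/-- The exponential weight of a test in epoch `j`, as a function of the digest of the history. -/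
def weight {k t : ℕ} (j : ℕ) (z : Fin t → (Fin k → ℕ) × Outcome k) (g : Test k (2 ^ j)) : ℝ :=
  Real.exp (learningRate j *
    ∑ s : Fin t, if 2 ^ j - 1 ≤ (s : ℕ) then gain g (z s).1 (z s).2 else 0)

theorem weight_digest {k : ℕ} (j t : ℕ) (g : Test k (2 ^ j)) (ω : ℕ → Round k) :
    weight j (digest j fun s : Fin t => ω s) g = Real.exp (learningRate j * score j t g ω) := by
  unfold weight score digest
  rw [Fin.sum_univ_eq_sum_range
    (fun s => if 2 ^ j - 1 ≤ s then gain g (cell (2 ^ j) (ω s).1) (ω s).2 else 0) t,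
    ← Finset.sum_filter]
  congr 3
  ext s
  simp [and_comm]

/-- A mixed forecast on the grid of epoch `j` that solves the one-round game with the current
exponential weights. -/
def mixedForecast {k t : ℕ} [NeZero k] (j : ℕ) (z : Fin t → (Fin k → ℕ) × Outcome k) :
    Grid k (2 ^ j) → ℝ :=
  (exists_mixed_forecast (weight j z) fun _ => (Real.exp_pos _).le).choose

theorem mixedForecast_mem {k t : ℕ} [NeZero k] (j : ℕ) (z : Fin t → (Fin k → ℕ) × Outcome k) :
    mixedForecast j z ∈ stdSimplex ℝ (Grid k (2 ^ j)) :=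
  (exists_mixed_forecast (weight j z) fun _ => (Real.exp_pos _).le).choose_spec.1

theorem sum_mixedForecast_mul_le {k t : ℕ} [NeZero k] (j : ℕ)
    (z : Fin t → (Fin k → ℕ) × Outcome k) (x : Outcome k) :
    ∑ n, mixedForecast j z n * ∑ g, weight j z g * gain g n.1 x
      ≤ 2 * k / (2 ^ j : ℕ) * ∑ g, weight j z g :=
  (exists_mixed_forecast (weight j z) fun _ => (Real.exp_pos _).le).choose_spec.2 x

/-- The law on the simplex of a random grid point. -/
def gridLaw {k m : ℕ} [NeZero m] (q : Grid k m → ℝ) : Measure (Forecast k) :=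
  ∑ n, ENNReal.ofReal (q n) • Measure.dirac (gridPoint n)

theorem lintegral_gridLaw {k m : ℕ} [NeZero m] (q : Grid k m → ℝ) (F : Forecast k → ENNReal) :
    ∫⁻ f, F f ∂(gridLaw q) = ∑ n, ENNReal.ofReal (q n) * F (gridPoint n) := by
  unfold gridLaw
  rw [lintegral_finsetSum_measure]
  simp [lintegral_smul_measure]

theorem isProbabilityMeasure_gridLaw {k m : ℕ} [NeZero m] {q : Grid k m → ℝ}
    (hq : q ∈ stdSimplex ℝ (Grid k m)) : IsProbabilityMeasure (gridLaw q) := by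
  constructor
  rw [← lintegral_one, lintegral_gridLaw]
  simp only [mul_one]
  rw [← ENNReal.ofReal_sum_of_nonneg fun n _ => hq.1 n, hq.2, ENNReal.ofReal_one]

/-- Exponential weights over all tests, restarted in each epoch on a grid twice as fine. -/
def strategy (k : ℕ) [NeZero k] : PlayerStrategy k where
  move t :=
    ⟨fun h => gridLaw (mixedForecast (Nat.log 2 (t + 1)) (digest (Nat.log 2 (t + 1)) h)),
      (Measurable.of_discrete (f := fun z => gridLaw (mixedForecast (Nat.log 2 (t + 1)) z))).comp
        (measurable_digest _)⟩
  isMarkov _ := ⟨fun _ => isProbabilityMeasure_gridLaw (mixedForecast_mem _ _)⟩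

theorem strategy_move_apply {k : ℕ} [NeZero k] {j t : ℕ} (ht : Nat.log 2 (t + 1) = j)
    (h : History k t) :
    (strategy k).move t h = gridLaw (mixedForecast j (digest j h)) := by
  subst ht; rfl

/-! ### Growth of the potential in one round -/

theorem exp_le_one_add_add_sq {y : ℝ} (hy : |y| ≤ 1) : Real.exp y ≤ 1 + y + y ^ 2 := by
  have := (abs_le.1 (Real.abs_exp_sub_one_sub_id_le hy)).2
  linarith

/-- The expected potential of epoch `j` grows by a factor of at most `1 + growth k j` per round. -/
def growth (k j : ℕ) : ℝ := 2 * k / 2 ^ j * learningRate j + 4 * learningRate j ^ 2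

theorem growth_nonneg (k j : ℕ) : 0 ≤ growth k j := by
  have := learningRate_nonneg j
  unfold growth; positivity

/-- The first-order term of the exponential is controlled by the choice of the mixed forecast, the
second-order term by the bound `2` on the gains. -/
theorem sum_mixedForecast_mul_exp_le {k t : ℕ} [NeZero k] (j : ℕ)
    (z : Fin t → (Fin k → ℕ) × Outcome k) (x : Outcome k) :
    ∑ n, mixedForecast j z n * ∑ g, weight j z g * Real.exp (learningRate j * gain g n.1 x)
      ≤ (1 + growth k j) * ∑ g, weight j z g := by
  have hη := learningRate_nonneg j
  have hη' := learningRate_le j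
  have hq := mixedForecast_mem j z
  have hw : ∀ g, 0 ≤ weight j z g := fun _ => (Real.exp_pos _).le
  calc _ ≤ ∑ n, mixedForecast j z n * ∑ g, weight j z g *
          (1 + learningRate j * gain g n.1 x + 4 * learningRate j ^ 2) := by
        refine Finset.sum_le_sum fun n _ => mul_le_mul_of_nonneg_left
          (Finset.sum_le_sum fun g _ => mul_le_mul_of_nonneg_left ?_ (hw g)) (hq.1 n)
        have hg := abs_gain_le g n x
        have h1 : |learningRate j * gain g n.1 x| ≤ 1 := by
          rw [abs_mul, abs_of_nonneg hη]
          nlinarith [abs_nonneg (gain g n.1 x)]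
        refine (exp_le_one_add_add_sq h1).trans ?_
        have h2 : (gain g n.1 x) ^ 2 ≤ 4 := by
          rw [← sq_abs]; nlinarith [abs_nonneg (gain g n.1 x)]
        rw [mul_pow]
        nlinarith [sq_nonneg (learningRate j)]
    _ = (1 + 4 * learningRate j ^ 2) * (∑ n, mixedForecast j z n) * ∑ g, weight j z g
        + learningRate j * ∑ n, mixedForecast j z n * ∑ g, weight j z g * gain g n.1 x := by
        have e : ∀ n : Grid k (2 ^ j), ∑ g, weight j z g *
            (1 + learningRate j * gain g n.1 x + 4 * learningRate j ^ 2)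
            = (1 + 4 * learningRate j ^ 2) * ∑ g, weight j z g
              + learningRate j * ∑ g, weight j z g * gain g n.1 x := fun n => by
          rw [Finset.mul_sum, Finset.mul_sum, ← Finset.sum_add_distrib]
          exact Finset.sum_congr rfl fun g _ => by ring
        simp only [e]
        generalize ∑ g, weight j z g = S
        rw [mul_right_comm, Finset.mul_sum, Finset.mul_sum _ _ (learningRate j),
          ← Finset.sum_add_distrib]
        exact Finset.sum_congr rfl fun n _ => by ring
    _ ≤ (1 + 4 * learningRate j ^ 2) * 1 * ∑ g, weight j z g
        + learningRate j * (2 * k / (2 ^ j : ℕ) * ∑ g, weight j z g) := by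
        rw [hq.2]
        gcongr
        exact sum_mixedForecast_mul_le j z x
    _ = _ := by
        unfold growth
        push_cast
        ring

theorem lintegral_strategy_potential_le {k : ℕ} [NeZero k] {j t : ℕ}
    (ht : Nat.log 2 (t + 1) = j) (h : History k t) (x : Outcome k) :
    ∫⁻ f, ENNReal.ofReal (∑ g : Test k (2 ^ j), weight j (digest j h) g *
        Real.exp (learningRate j * gain g (cell (2 ^ j) f) x)) ∂((strategy k).move t h)
      ≤ ENNReal.ofReal (1 + growth k j) *
        ENNReal.ofReal (∑ g : Test k (2 ^ j), weight j (digest j h) g) := by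
  have hq := mixedForecast_mem j (digest j h)
  rw [strategy_move_apply ht, lintegral_gridLaw]
  simp only [cell_gridPoint]
  simp_rw [← ENNReal.ofReal_mul (hq.1 _)]
  rw [← ENNReal.ofReal_sum_of_nonneg, ← ENNReal.ofReal_mul (by linarith [growth_nonneg k j])]
  · exact ENNReal.ofReal_le_ofReal (sum_mixedForecast_mul_exp_le j _ x)
  · intro n _
    exact mul_nonneg (hq.1 n) (Finset.sum_nonneg fun g _ =>
      mul_nonneg (Real.exp_pos _).le (Real.exp_pos _).le)

/-! ### The law of one round -/

theorem map_eval_zero_playLaw {k : ℕ} (π : PlayerStrategy k) (a : AdversaryStrategy k) :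
    (playLaw π a).map (fun ω => ω 0) = roundKernel π a 0 (fun i : Fin 0 => i.elim0) := by
  unfold playLaw Kernel.trajMeasure
  have : (fun ω : ℕ → Round k => ω 0)
      = (fun y : (i : Finset.Iic 0) → Round k => y ⟨0, by simp⟩) ∘ Preorder.frestrictLe 0 := rfl
  rw [this, ← Measure.map_map (by fun_prop) (by fun_prop), Measure.map_comp _ _ (by fun_prop),
    Kernel.traj_map_frestrictLe, Kernel.partialTraj_self, Measure.id_comp,
    Measure.map_map (by fun_prop) (by fun_prop)]
  exact Measure.map_id

instance isProbabilityMeasure_playLaw {k : ℕ} (π : PlayerStrategy k) (a : AdversaryStrategy k) :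
    IsProbabilityMeasure (playLaw π a) := by
  unfold playLaw; infer_instance

/-- Conditional expectation of a function of the first `t + 1` rounds given the first `t`: the
forecast is averaged first, for each fixed outcome, which is possible as the two moves are
independent given the history. -/
theorem lintegral_round {k : ℕ} (π : PlayerStrategy k) (a : AdversaryStrategy k) (t : ℕ)
    {F : History k t × Round k → ENNReal} (hF : Measurable F) :
    ∫⁻ ω, F (fun s : Fin t => ω s, ω t) ∂(playLaw π a)
      = ∫⁻ ω, ∫⁻ x, ∫⁻ f, F (fun s : Fin t => ω s, (f, x)) ∂(π.move t fun s : Fin t => ω s)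
        ∂(a.move t fun s : Fin t => ω s) ∂(playLaw π a) := by
  have key : ∫⁻ ω, F (fun s : Fin t => ω s, ω t) ∂(playLaw π a)
      = ∫⁻ ω, ∫⁻ r, F (fun s : Fin t => ω s, r) ∂(roundKernel π a t fun s : Fin t => ω s)
        ∂(playLaw π a) := by
    cases t with
    | zero =>
      have e : ∀ ω : ℕ → Round k, (fun s : Fin 0 => ω s) = fun i => i.elim0 := fun ω =>
        Subsingleton.elim _ _
      simp only [e, lintegral_const, measure_univ, mul_one]
      rw [← map_eval_zero_playLaw π a, lintegral_map (by fun_prop) (by fun_prop)]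
    | succ n =>
      have h := Kernel.map_frestrictLe_trajMeasure_compProd_eq_map_trajMeasure
        (X := fun _ => Round k) (μ₀ := roundKernel π a 0 (fun i : Fin 0 => i.elim0))
        (κ := fun n => (roundKernel π a (n + 1)).comap (toHistory n) (measurable_toHistory n))
        (a := n)
      set G : ((i : Finset.Iic n) → Round k) × Round k → ENNReal :=
        fun y => F (toHistory n y.1, y.2) with hG
      have hGm : Measurable G :=
        hF.comp (((measurable_toHistory n).comp measurable_fst).prodMk measurable_snd)
      have h' := congrArg (fun μ => ∫⁻ y, G y ∂μ) h
      rw [Measure.lintegral_compProd hGm, lintegral_map (by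
          exact hGm.lintegral_kernel_prod_right') (by fun_prop),
        lintegral_map hGm (by fun_prop)] at h'
      exact h'.symm
  rw [key]
  refine lintegral_congr fun ω => ?_
  have := π.isMarkov t
  have := a.isMarkov t
  unfold roundKernel
  rw [Kernel.prod_apply, lintegral_prod_symm']
  exact hF.comp measurable_prodMk_left

/-! ### The potential of an epoch -/

/-- The exponential potential of epoch `j` before round `t`. -/
def potential {k : ℕ} (j t : ℕ) (ω : ℕ → Round k) : ℝ :=
  ∑ g : Test k (2 ^ j), Real.exp (learningRate j * score j t g ω)

theorem pow_sub_one_le_of_log_eq {j t : ℕ} (ht : Nat.log 2 (t + 1) = j) : 2 ^ j - 1 ≤ t := by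
  have := Nat.pow_log_le_self 2 (Nat.succ_ne_zero t)
  rw [Nat.succ_eq_add_one, ht] at this
  omega

theorem potential_succ {k : ℕ} {j t : ℕ} (ht : Nat.log 2 (t + 1) = j) (ω : ℕ → Round k) :
    potential j (t + 1) ω = ∑ g : Test k (2 ^ j), weight j (digest j fun s : Fin t => ω s) g *
      Real.exp (learningRate j * gain g (cell (2 ^ j) (ω t).1) (ω t).2) := by
  unfold potential
  refine Finset.sum_congr rfl fun g _ => ?_
  rw [weight_digest, ← Real.exp_add, ← mul_add]
  unfold score
  rw [Finset.sum_Ico_succ_top (pow_sub_one_le_of_log_eq ht)]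

theorem measurable_potential {k : ℕ} (j t : ℕ) : Measurable (potential (k := k) j t) := by
  have : potential (k := k) j t = (fun z => ∑ g, weight j z g) ∘ digest j ∘
      fun (ω : ℕ → Round k) (s : Fin t) => ω s := by
    ext ω
    simp only [Function.comp_apply, weight_digest]
    rfl
  rw [this]
  exact Measurable.of_discrete.comp ((measurable_digest j).comp (by fun_prop))

/-- Up to a factor close to `1` the potential is a supermartingale within its epoch, whatever the
adversary does. -/
theorem lintegral_potential_succ_le {k : ℕ} [NeZero k] (a : AdversaryStrategy k) {j t : ℕ}
    (ht : Nat.log 2 (t + 1) = j) :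
    ∫⁻ ω, ENNReal.ofReal (potential j (t + 1) ω) ∂(playLaw (strategy k) a)
      ≤ ENNReal.ofReal (1 + growth k j) *
        ∫⁻ ω, ENNReal.ofReal (potential j t ω) ∂(playLaw (strategy k) a) := by
  set F : History k t × Round k → ENNReal := fun y => ENNReal.ofReal
    (∑ g : Test k (2 ^ j), weight j (digest j y.1) g *
      Real.exp (learningRate j * gain g (cell (2 ^ j) y.2.1) y.2.2)) with hF
  have hFm : Measurable F := by
    have : F = (fun z : (Fin t → (Fin k → ℕ) × Outcome k) × ((Fin k → ℕ) × Outcome k) =>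
        ENNReal.ofReal (∑ g : Test k (2 ^ j), weight j z.1 g *
          Real.exp (learningRate j * gain g z.2.1 z.2.2))) ∘
        fun y => (digest j y.1, (cell (2 ^ j) y.2.1, y.2.2)) := rfl
    rw [this]
    exact Measurable.of_discrete.comp (((measurable_digest j).comp measurable_fst).prodMk
      (((measurable_cell _).comp (measurable_fst.comp measurable_snd)).prodMk
        (measurable_snd.comp measurable_snd)))
  calc _ = ∫⁻ ω, F (fun s : Fin t => ω s, ω t) ∂(playLaw (strategy k) a) :=
        lintegral_congr fun ω => by rw [potential_succ ht]
    _ = _ := lintegral_round _ _ t hFm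
    _ ≤ ∫⁻ ω, ENNReal.ofReal (1 + growth k j) * ENNReal.ofReal (potential j t ω)
          ∂(playLaw (strategy k) a) := by
        refine lintegral_mono fun ω => ?_
        have := a.isMarkov t
        calc _ ≤ ∫⁻ _x, ENNReal.ofReal (1 + growth k j) * ENNReal.ofReal
              (∑ g : Test k (2 ^ j), weight j (digest j fun s : Fin t => ω s) g)
              ∂(a.move t fun s : Fin t => ω s) :=
              lintegral_mono fun x => lintegral_strategy_potential_le ht _ x
          _ = _ := by
              rw [lintegral_const, measure_univ, mul_one]
              simp only [weight_digest]
              rfl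
    _ = _ := lintegral_const_mul _ (measurable_potential j t).ennreal_ofReal

theorem lintegral_potential_le {k : ℕ} [NeZero k] (a : AdversaryStrategy k) (j i : ℕ)
    (hi : i ≤ 2 ^ j) :
    ∫⁻ ω, ENNReal.ofReal (potential j (2 ^ j - 1 + i) ω) ∂(playLaw (strategy k) a)
      ≤ ENNReal.ofReal (1 + growth k j) ^ i * (Fintype.card (Test k (2 ^ j)) : ENNReal) := by
  have hj : 1 ≤ 2 ^ j := Nat.one_le_two_pow
  induction i with
  | zero =>
    simp only [potential, score, add_zero, Finset.Ico_self, Finset.sum_empty, mul_zero,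
      Real.exp_zero, Finset.sum_const, Finset.card_univ, nsmul_one, ENNReal.ofReal_natCast,
      lintegral_const, measure_univ, mul_one, pow_zero, one_mul, le_refl]
  | succ i ih =>
    have hlog : Nat.log 2 (2 ^ j - 1 + i + 1) = j := by
      rw [Nat.log_eq_iff (Or.inr ⟨by norm_num, by omega⟩), pow_succ]
      omega
    rw [← add_assoc]
    refine (lintegral_potential_succ_le a hlog).trans ?_
    rw [pow_succ', mul_assoc]
    gcongr
    exact ih (by omega)

theorem lintegral_potential_le_exp {k : ℕ} [NeZero k] (a : AdversaryStrategy k) {j t : ℕ}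
    (ht : Nat.log 2 t = j) (ht0 : t ≠ 0) :
    ∫⁻ ω, ENNReal.ofReal (potential j t ω) ∂(playLaw (strategy k) a)
      ≤ ENNReal.ofReal (Real.exp (growth k j * 2 ^ j) * Fintype.card (Test k (2 ^ j))) := by
  obtain ⟨h1, h2⟩ := (Nat.log_eq_iff (Or.inr ⟨by norm_num, ht0⟩)).1 ht
  rw [pow_succ] at h2
  have hg := growth_nonneg k j
  have e : t = 2 ^ j - 1 + (t - (2 ^ j - 1)) := by omega
  have hle : t - (2 ^ j - 1) ≤ 2 ^ j := by omega
  rw [e]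
  refine (lintegral_potential_le a j _ hle).trans ?_
  rw [← ENNReal.ofReal_pow (by linarith), ← ENNReal.ofReal_natCast,
    ← ENNReal.ofReal_mul (by positivity)]
  refine ENNReal.ofReal_le_ofReal (mul_le_mul_of_nonneg_right ?_ (by positivity))
  calc (1 + growth k j) ^ (t - (2 ^ j - 1)) ≤ (1 + growth k j) ^ (2 ^ j) :=
        pow_le_pow_right₀ (by linarith) hle
    _ ≤ Real.exp (growth k j) ^ (2 ^ j) :=
        pow_le_pow_left₀ (by linarith) (by linarith [Real.add_one_le_exp (growth k j)]) _
    _ = _ := by rw [← Real.exp_nat_mul]; push_cast; ring_nf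

/-! ### Almost sure bound on the scores -/

/-- The bound on the scores in epoch `j`. -/
def scoreBound (k j : ℕ) : ℝ := 10 * k * √((j : ℝ) * 2 ^ j)

theorem learningRate_mul_scoreBound (k j : ℕ) : learningRate j * scoreBound k j = 5 * k * j := by
  have h : √((j : ℝ) / 2 ^ j) * √((j : ℝ) * 2 ^ j) = j := by
    rw [← Real.sqrt_mul (by positivity)]
    have : (j : ℝ) / 2 ^ j * (j * 2 ^ j) = (j : ℝ) ^ 2 := by field_simp
    rw [this, Real.sqrt_sq (by positivity)]
  unfold learningRate scoreBound
  linear_combination (5 * (k : ℝ)) * h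

theorem growth_mul_two_pow_le (k j : ℕ) : growth k j * 2 ^ j ≤ k + j := by
  have h : learningRate j ^ 2 * 2 ^ j = j / 4 := by
    unfold learningRate
    rw [div_pow, Real.sq_sqrt (by positivity)]
    field_simp
    norm_num
  have e : growth k j * 2 ^ j = 2 * k * learningRate j + 4 * (learningRate j ^ 2 * 2 ^ j) := by
    unfold growth
    field_simp
  rw [e, h]
  nlinarith [learningRate_le j, Nat.cast_nonneg (α := ℝ) k]

/-- The factor of the number of tests that does not depend on the mesh. -/
def testConst (k : ℕ) : ℝ := 2 ^ k * (2 ^ k * (3 * (2 * k + 1) ^ 2 ^ k))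

theorem two_pow_le_exp (j : ℕ) : (2 : ℝ) ^ j ≤ Real.exp j := by
  rw [← mul_one (j : ℝ), Real.exp_nat_mul]
  exact pow_le_pow_left₀ (by norm_num) (by linarith [Real.add_one_le_exp (1 : ℝ)]) _

theorem card_test_le (k j : ℕ) :
    (Fintype.card (Test k (2 ^ j)) : ℝ) ≤ testConst k * Real.exp (j * (k + 1)) := by
  have h1 : (1 : ℝ) ≤ 2 ^ j := one_le_pow₀ (by norm_num)
  have h2 := two_pow_le_exp j
  rw [card_test]
  push_cast
  calc (2 : ℝ) ^ k * ((2 ^ j + 1) ^ k * ((2 * 2 ^ j + 1) * (2 * k + 1) ^ 2 ^ k))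
      ≤ 2 ^ k * ((2 * 2 ^ j) ^ k * ((3 * 2 ^ j) * (2 * k + 1) ^ 2 ^ k)) := by
        gcongr <;> linarith
    _ = testConst k * (2 ^ j) ^ (k + 1) := by
        unfold testConst; rw [mul_pow, pow_succ]; ring
    _ ≤ testConst k * Real.exp j ^ (k + 1) := by
        gcongr
        unfold testConst; positivity
    _ = _ := by rw [← Real.exp_nat_mul]; push_cast; ring_nf

/-- Markov's inequality for the potential. Up to constants that depend on `k`, the exponent `5 * k * j`
beats the logarithm `(k + 1) * j` of the number of tests and the growth `j`, and leaves
`exp (-2 * j)`, which is at most `4 / t ^ 2`. -/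
theorem measure_potential_ge_le {k : ℕ} [NeZero k] (a : AdversaryStrategy k) {t : ℕ}
    (ht0 : t ≠ 0) :
    playLaw (strategy k) a {ω | ENNReal.ofReal (Real.exp (5 * k * (Nat.log 2 t : ℕ)))
        ≤ ENNReal.ofReal (potential (Nat.log 2 t) t ω)}
      ≤ ENNReal.ofReal (4 * testConst k * Real.exp k * (1 / (t : ℝ) ^ 2)) := by
  set j := Nat.log 2 t with hj
  have hk : (1 : ℝ) ≤ k := by exact_mod_cast NeZero.one_le
  have hM := meas_ge_le_lintegral_div (μ := playLaw (strategy k) a)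
    (measurable_potential (k := k) j t).ennreal_ofReal.aemeasurable
    (ε := ENNReal.ofReal (Real.exp (5 * k * j)))
    (by simpa using Real.exp_pos _) ENNReal.ofReal_ne_top
  refine hM.trans ?_
  refine (ENNReal.div_le_div_right (lintegral_potential_le_exp a hj.symm ht0) _).trans ?_
  rw [← ENNReal.ofReal_div_of_pos (Real.exp_pos _)]
  refine ENNReal.ofReal_le_ofReal ?_
  have hc : 0 ≤ testConst k := by unfold testConst; positivity
  have ht : (t : ℝ) < 2 * 2 ^ j := by
    have := Nat.lt_pow_succ_log_self (b := 2) (by norm_num) t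
    rw [Nat.succ_eq_add_one, pow_succ', ← hj] at this
    exact_mod_cast this
  have htp : (0 : ℝ) < t := by exact_mod_cast Nat.pos_of_ne_zero ht0
  have h4 : Real.exp (-(2 * j)) ≤ 4 * (1 / (t : ℝ) ^ 2) := by
    have h2 := two_pow_le_exp j
    have h3 : Real.exp (2 * j) = Real.exp j ^ 2 := by
      rw [← Real.exp_nat_mul]; norm_num
    rw [Real.exp_neg, h3, mul_one_div, inv_eq_one_div,
      div_le_div_iff₀ (by positivity) (by positivity)]
    nlinarith [pow_le_pow_left₀ htp.le (ht.le.trans (by gcongr : 2 * 2 ^ j ≤ 2 * Real.exp j)) 2]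
  calc Real.exp (growth k j * 2 ^ j) * Fintype.card (Test k (2 ^ j)) / Real.exp (5 * k * j)
      ≤ Real.exp (k + j) * (testConst k * Real.exp (j * (k + 1))) / Real.exp (5 * k * j) := by
        gcongr
        · exact growth_mul_two_pow_le k j
        · exact card_test_le k j
    _ = testConst k * Real.exp k * Real.exp (j + j * (k + 1) - 5 * k * j) := by
        rw [Real.exp_sub, Real.exp_add, Real.exp_add]; ring
    _ ≤ testConst k * Real.exp k * Real.exp (-(2 * j)) := by
        gcongr
        nlinarith [Nat.cast_nonneg (α := ℝ) j]
    _ ≤ testConst k * Real.exp k * (4 * (1 / (t : ℝ) ^ 2)) := by gcongr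
    _ = _ := by ring

/-- By the Borel-Cantelli lemma over all rounds `t`; the potential bounds every single score. -/
theorem ae_eventually_score_le {k : ℕ} [NeZero k] (a : AdversaryStrategy k) :
    ∀ᵐ ω ∂(playLaw (strategy k) a), ∀ᶠ t in atTop, ∀ g : Test k (2 ^ Nat.log 2 t),
      score (Nat.log 2 t) t g ω ≤ scoreBound k (Nat.log 2 t) := by
  set B : ℕ → Set (ℕ → Round k) := fun t =>
    {ω | ENNReal.ofReal (Real.exp (5 * k * (Nat.log 2 (t + 1) : ℕ)))
        ≤ ENNReal.ofReal (potential (Nat.log 2 (t + 1)) (t + 1) ω)} with hB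
  have hsum : ∑' t, playLaw (strategy k) a (B t) ≠ ⊤ := by
    have hs : Summable fun t : ℕ => 4 * testConst k * Real.exp k * (1 / ((t + 1 : ℕ) : ℝ) ^ 2) :=
      ((summable_nat_add_iff 1).2 (Real.summable_one_div_nat_pow.2 one_lt_two)).mul_left _
    exact ne_top_of_le_ne_top hs.tsum_ofReal_ne_top
      (ENNReal.tsum_le_tsum fun t => measure_potential_ge_le a (Nat.succ_ne_zero t))
  filter_upwards [ae_eventually_notMem hsum] with ω hω
  obtain ⟨N, hN⟩ := eventually_atTop.1 hω
  filter_upwards [eventually_ge_atTop (N + 2)] with t ht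
  have h := hN (t - 1) (by omega)
  have e : t - 1 + 1 = t := by omega
  simp only [hB, Set.mem_ofPred_eq, not_le, e] at h
  set j := Nat.log 2 t with hj
  intro g
  -- The learning rate vanishes in epoch `0`, which therefore has to be left out.
  have hj1 : 1 ≤ j := Nat.le_log_of_pow_le (by norm_num) (by omega)
  have hη : 0 < learningRate j := by
    unfold learningRate
    have : (0 : ℝ) < j := by exact_mod_cast hj1
    positivity
  have h1 := (ENNReal.ofReal_lt_ofReal_iff (Real.exp_pos _)).1 h
  have h2 : Real.exp (learningRate j * score j t g ω) ≤ potential j t ω :=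
    Finset.single_le_sum (f := fun g => Real.exp (learningRate j * score j t g ω))
      (fun g _ => (Real.exp_pos _).le) (Finset.mem_univ g)
  have h3 := Real.exp_lt_exp.1 (h2.trans_lt h1)
  rw [← learningRate_mul_scoreBound] at h3
  exact (lt_of_mul_lt_mul_left h3 hη.le).le

/-- Almost surely all forecasts lie on the grid of their epoch. -/
theorem ae_mem_range_gridPoint {k : ℕ} [NeZero k] (a : AdversaryStrategy k) :
    ∀ᵐ ω ∂(playLaw (strategy k) a), ∀ j t, Nat.log 2 (t + 1) = j →
      (ω t).1 ∈ Set.range (gridPoint (k := k) (m := 2 ^ j)) := by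
  rw [ae_all_iff]; intro j
  rw [ae_all_iff]; intro t
  rw [eventually_imp_distrib_left]; intro ht
  set R : Set (Forecast k) := (Set.range (gridPoint (k := k) (m := 2 ^ j)))ᶜ with hR
  have hRm : MeasurableSet R := (Set.finite_range _).measurableSet.compl
  have hI : Measurable (R.indicator fun _ => (1 : ENNReal)) := measurable_const.indicator hRm
  have h0 : ∫⁻ ω, R.indicator (fun _ => (1 : ENNReal)) (ω t).1 ∂(playLaw (strategy k) a) = 0 := by
    rw [lintegral_round (strategy k) a t
      (F := fun y => R.indicator (fun _ => (1 : ENNReal)) y.2.1)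
      (hI.comp (measurable_fst.comp measurable_snd))]
    simp only [strategy_move_apply ht, lintegral_gridLaw]
    simp [hR]
  have hIt : Measurable fun ω : ℕ → Round k => R.indicator (fun _ => (1 : ENNReal)) (ω t).1 :=
    hI.comp (measurable_fst.comp (measurable_pi_apply t))
  rw [lintegral_eq_zero_iff hIt] at h0
  filter_upwards [h0] with ω hω
  by_contra hcon
  have : (ω t).1 ∈ R := hcon
  simp [this] at hω

/-! ### Summation over the epochs -/

theorem l1Norm_sum_range_payoff_le_two_mul {k : ℕ} (ω : ℕ → Round k) (T : ℕ) (r : ℝ)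
    (p : Forecast k) : l1Norm (∑ t ∈ Finset.range T, payoff r p (ω t)) ≤ 2 * T := by
  refine (l1Norm_sum_le _ _).trans ((Finset.sum_le_sum fun t _ => l1Norm_payoff_le r p _).trans ?_)
  simp [mul_comm]

/-- The bounds of the epochs add up geometrically to a multiple of the last one. -/
theorem exists_l1Norm_sum_payoff_le {k : ℕ} {ω : ℕ → Round k}
    (hgrid : ∀ j t, Nat.log 2 (t + 1) = j →
      (ω t).1 ∈ Set.range (gridPoint (k := k) (m := 2 ^ j)))
    (hscore : ∀ᶠ t in atTop, ∀ g : Test k (2 ^ Nat.log 2 t),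
      score (Nat.log 2 t) t g ω ≤ scoreBound k (Nat.log 2 t)) :
    ∃ C : ℝ, 0 ≤ C ∧ ∀ T ≠ 0, ∀ r > 0, ∀ p : Forecast k,
      l1Norm (∑ t ∈ Finset.range T, payoff r p (ω t)) ≤ C + 4 * scoreBound k (Nat.log 2 T) := by
  obtain ⟨N, hN⟩ := eventually_atTop.1 hscore
  have hsb : ∀ j, 0 ≤ scoreBound k j := fun j => by unfold scoreBound; positivity
  refine ⟨2 * N + 2, by positivity, fun T hT r hr p => ?_⟩
  induction hj : Nat.log 2 T generalizing T with
  | zero =>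
    have hT2 : T ≤ 1 := by
      rcases Nat.log_eq_zero_iff.1 hj with h | h <;> omega
    have : (T : ℝ) ≤ 1 := by exact_mod_cast hT2
    have := l1Norm_sum_range_payoff_le_two_mul ω T r p
    have := hsb 0
    have : (0 : ℝ) ≤ N := by positivity
    linarith
  | succ j ih =>
    by_cases hTN : T < N
    · have : (T : ℝ) ≤ N := by exact_mod_cast hTN.le
      have := l1Norm_sum_range_payoff_le_two_mul ω T r p
      have := hsb (j + 1)
      linarith
    obtain ⟨h1, h2⟩ := (Nat.log_eq_iff (Or.inr ⟨by norm_num, hT⟩)).1 hj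
    rw [pow_succ _ (j + 1)] at h2
    have hp : 1 ≤ 2 ^ j := Nat.one_le_two_pow
    have hp' : 2 ^ (j + 1) = 2 * 2 ^ j := pow_succ' _ _
    have hlog : Nat.log 2 (2 ^ (j + 1) - 1) = j := by
      rw [Nat.log_eq_iff (Or.inr ⟨by norm_num, by omega⟩)]
      omega
    have hprev := ih (2 ^ (j + 1) - 1) (by omega) hlog
    have hS := hN T (not_lt.1 hTN)
    rw [hj] at hS
    have hlast : l1Norm (∑ t ∈ Finset.Ico (2 ^ (j + 1) - 1) T, payoff r p (ω t))
        ≤ scoreBound k (j + 1) := by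
      refine l1Norm_sum_payoff_le (m := 2 ^ (j + 1)) _ ω (fun t ht => hgrid _ _ ?_) hS hr p
      rw [Finset.mem_Ico] at ht
      rw [Nat.log_eq_iff (Or.inr ⟨by norm_num, by omega⟩), pow_succ _ (j + 1)]
      omega
    rw [← Finset.sum_range_add_sum_Ico _ (show 2 ^ (j + 1) - 1 ≤ T by omega)]
    refine (l1Norm_add_le _ _).trans ((add_le_add hprev hlast).trans ?_)
    -- Since `√(1 / 2) ≤ 3 / 4`, three quarters of the new bound cover the earlier epochs.
    have hsq : √((j : ℝ) * 2 ^ j) ≤ 3 / 4 * √(((j + 1 : ℕ) : ℝ) * 2 ^ (j + 1)) := by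
      refine Real.sqrt_le_iff.2 ⟨by positivity, ?_⟩
      rw [mul_pow, Real.sq_sqrt (by positivity), pow_succ (2 : ℝ) j]
      push_cast
      nlinarith [Nat.cast_nonneg (α := ℝ) j, pow_pos (two_pos (α := ℝ)) j,
        mul_nonneg (Nat.cast_nonneg (α := ℝ) j) (pow_pos (two_pos (α := ℝ)) j).le]
    have : scoreBound k j ≤ 3 / 4 * scoreBound k (j + 1) := by
      unfold scoreBound
      nlinarith [Nat.cast_nonneg (α := ℝ) k]
    linarith

/-! ### The regret -/

theorem regret_nonneg {k : ℕ} (T : ℕ) (ω : ℕ → Round k) : 0 ≤ regret T ω :=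
  Real.iSup_nonneg fun _ => l1Norm_nonneg _

/-- On a play on the grids in which the scores obey their bounds, the regret is of order
`k * √(log T / T)`. -/
theorem exists_regret_le {k : ℕ} {ω : ℕ → Round k}
    (hgrid : ∀ j t, Nat.log 2 (t + 1) = j →
      (ω t).1 ∈ Set.range (gridPoint (k := k) (m := 2 ^ j)))
    (hscore : ∀ᶠ t in atTop, ∀ g : Test k (2 ^ Nat.log 2 t),
      score (Nat.log 2 t) t g ω ≤ scoreBound k (Nat.log 2 t)) :
    ∃ C : ℝ, 0 ≤ C ∧ ∀ T : ℕ, T ≠ 0 →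
      √(T : ℝ) * regret T ω ≤ C / √(T : ℝ) + 60 * k * √(Real.log T) := by
  obtain ⟨C, hC, h⟩ := exists_l1Norm_sum_payoff_le hgrid hscore
  refine ⟨C, hC, fun T hT => ?_⟩
  have hTp : (0 : ℝ) < T := by exact_mod_cast Nat.pos_of_ne_zero hT
  have hsT : 0 < √(T : ℝ) := Real.sqrt_pos.2 hTp
  set j := Nat.log 2 T with hj
  have hjT : (2 : ℝ) ^ j ≤ T := by exact_mod_cast Nat.pow_log_le_self 2 hT
  -- The constant only has to exceed `1 / log 2`; `9 / 4` has a rational square root.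
  have hjlog : (j : ℝ) ≤ 9 / 4 * Real.log T := by
    have h1 := Real.log_le_log (by positivity) hjT
    rw [Real.log_pow] at h1
    nlinarith [Real.log_two_gt_d9, Nat.cast_nonneg (α := ℝ) j]
  have hsb : 4 * scoreBound k j ≤ 60 * k * (√(Real.log T) * √(T : ℝ)) := by
    have hsq : √((j : ℝ) * 2 ^ j) ≤ 3 / 2 * (√(Real.log T) * √(T : ℝ)) := by
      have hl : 0 ≤ Real.log T := Real.log_natCast_nonneg T
      rw [← Real.sqrt_mul hl]
      refine Real.sqrt_le_iff.2 ⟨by positivity, ?_⟩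
      rw [mul_pow, Real.sq_sqrt (by positivity)]
      calc (j : ℝ) * 2 ^ j ≤ 9 / 4 * Real.log T * T := by gcongr
        _ = _ := by ring
    unfold scoreBound
    nlinarith [Nat.cast_nonneg (α := ℝ) k]
  have hreg : regret T ω ≤ (T : ℝ)⁻¹ * (C + 60 * k * (√(Real.log T) * √(T : ℝ))) := by
    refine Real.iSup_le (fun s => ?_) (by positivity)
    rw [l1Norm_smul, abs_of_pos (inv_pos.2 hTp)]
    gcongr
    exact (h T hT s.1.1 s.1.2 s.2).trans (by linarith)
  calc √(T : ℝ) * regret T ω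
      ≤ √(T : ℝ) * ((T : ℝ)⁻¹ * (C + 60 * k * (√(Real.log T) * √(T : ℝ)))) := by gcongr
    _ = _ := by
        have : (T : ℝ)⁻¹ = (√(T : ℝ))⁻¹ * (√(T : ℝ))⁻¹ := by
          rw [← mul_inv, Real.mul_self_sqrt hTp.le]
        rw [this]
        field_simp

theorem tendsto_regret_zero {k : ℕ} {ω : ℕ → Round k} {C : ℝ}
    (h : ∀ T : ℕ, T ≠ 0 → √(T : ℝ) * regret T ω ≤ C / √(T : ℝ) + 60 * k * √(Real.log T)) :
    Tendsto (fun T : ℕ => regret T ω) atTop (𝓝 0) := by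
  have hlog : Tendsto (fun T : ℕ => Real.log T / T) atTop (𝓝 0) :=
    (Real.isLittleO_log_id_atTop.tendsto_div_nhds_zero).comp tendsto_natCast_atTop_atTop
  have hlim : Tendsto (fun T : ℕ => C / (T : ℝ) + 60 * k * √(Real.log T / T)) atTop (𝓝 0) := by
    have := (tendsto_const_div_atTop_nhds_zero_nat C).add
      (((Real.continuous_sqrt.tendsto 0).comp hlog).const_mul (60 * (k : ℝ)))
    simpa using this
  refine squeeze_zero' (Eventually.of_forall fun T => regret_nonneg T ω) ?_ hlim
  filter_upwards [eventually_ne_atTop 0] with T hT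
  have hTp : (0 : ℝ) < T := by exact_mod_cast Nat.pos_of_ne_zero hT
  have hsT : 0 < √(T : ℝ) := Real.sqrt_pos.2 hTp
  refine le_of_mul_le_mul_left ((h T hT).trans_eq ?_) hsT
  have e : (T : ℝ) = √(T : ℝ) * √(T : ℝ) := (Real.mul_self_sqrt hTp.le).symm
  rw [Real.sqrt_div' _ hTp.le, mul_add]
  congr 1
  · rw [mul_div_assoc', div_eq_div_iff hsT.ne' hTp.ne']
    linear_combination C * e
  · field_simp

/-- With `8` in place of the constant `c` of the normalization, its second term alone makes the
denominator at least `2 * k ^ 2 * √(log T)`. -/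
theorem eventually_normalized_regret_le {k : ℕ} [NeZero k] {ω : ℕ → Round k} {C : ℝ}
    (h : ∀ T : ℕ, T ≠ 0 → √(T : ℝ) * regret T ω ≤ C / √(T : ℝ) + 60 * k * √(Real.log T)) :
    ∀ᶠ T : ℕ in atTop, √(T : ℝ) / √(3 * (k : ℝ) * Real.log (2 * T)
      + 8 * (k : ℝ) ^ 4 / 2 * Real.log T) * regret T ω ≤ 60 := by
  have hk : (1 : ℝ) ≤ k := by exact_mod_cast NeZero.one_le
  have h1 : ∀ᶠ T : ℕ in atTop, C / √(T : ℝ) < 1 :=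
    ((Real.tendsto_sqrt_atTop.comp tendsto_natCast_atTop_atTop).const_div_atTop
      C).eventually_lt_const one_pos
  have h2 : ∀ᶠ T : ℕ in atTop, 1 ≤ Real.log T :=
    (Real.tendsto_log_atTop.comp tendsto_natCast_atTop_atTop).eventually_ge_atTop 1
  filter_upwards [h1, h2, eventually_ne_atTop 0] with T hT1 hT2 hT
  have hTp : (0 : ℝ) < T := by exact_mod_cast Nat.pos_of_ne_zero hT
  have hl : 1 ≤ √(Real.log T) := Real.one_le_sqrt.2 hT2
  have hl2 : 0 ≤ Real.log (2 * T) := by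
    have : (1 : ℝ) ≤ T := by exact_mod_cast Nat.pos_of_ne_zero hT
    exact Real.log_nonneg (by linarith)
  have hden : 2 * k ^ 2 * √(Real.log T) ≤
      √(3 * (k : ℝ) * Real.log (2 * T) + 8 * (k : ℝ) ^ 4 / 2 * Real.log T) := by
    refine Real.le_sqrt_of_sq_le ?_
    rw [mul_pow, Real.sq_sqrt (by linarith)]
    nlinarith [mul_nonneg (Nat.cast_nonneg (α := ℝ) k) hl2]
  have hdpos : 0 < 2 * (k : ℝ) ^ 2 * √(Real.log T) := by positivity
  rw [div_mul_eq_mul_div, div_le_iff₀ (hdpos.trans_le hden)]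
  have hkk : (k : ℝ) * √(Real.log T) ≤ k ^ 2 * √(Real.log T) := by
    gcongr
    nlinarith
  have hkl : 1 ≤ (k : ℝ) ^ 2 * √(Real.log T) := by
    nlinarith [one_le_pow₀ hk (n := 2)]
  linarith [h T hT]

end Calibration

end

theorem mainTheorem12 :
    ∃ c : ℝ, 0 < c ∧ ∀ k : ℕ, 1 ≤ k →
      ∃ π : Calibration.PlayerStrategy k, ∀ a : Calibration.AdversaryStrategy k,
        ∀ᵐ ω ∂(Calibration.playLaw π a),
          limsup (fun T : ℕ =>
            ((√(T : ℝ) / √(3 * (k : ℝ) * Real.log (2 * T) + c * (k : ℝ) ^ 4 / 2 * Real.log T)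
              * Calibration.regret T ω : ℝ) : EReal)) atTop ≤ 60 ∧
          Tendsto (fun T : ℕ => Calibration.regret T ω) atTop (𝓝 0) := by
  refine ⟨8, by norm_num, fun k hk => ?_⟩
  have : NeZero k := ⟨by omega⟩
  refine ⟨Calibration.strategy k, fun a => ?_⟩
  filter_upwards [Calibration.ae_mem_range_gridPoint a, Calibration.ae_eventually_score_le a]
    with ω hgrid hscore
  obtain ⟨C, -, hC⟩ := Calibration.exists_regret_le hgrid hscore
  refine ⟨limsup_le_of_le (h := ?_), Calibration.tendsto_regret_zero hC⟩
  filter_upwards [Calibration.eventually_normalized_regret_le hC] with T hT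
  exact (EReal.coe_le_coe_iff.2 hT).trans_eq (by norm_cast)
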